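/- **Theorem 3 (Lower bound on the minimax risk).** There is an absolute constant $\varepsilon_1>0$ such that the following holds for every $c\in(0,1/2)$ (in particular for $c=0.1$) and every fixed $\kappa>0$. For $m=\kappa n$, let $a_1,\dots,a_m$ be independent $\mathcal N(0,I_n)$ vectors in $\mathbb R^n$ and, given $\{a_i\}$ and a signal $x\in\mathbb R^n$, let $y_1,\dots,y_m$ be independent with $y_i\sim\mathsf{Poisson}(|\langle a_i,x\rangle|^2)$. Write $\mathrm{dist}(z,x)=\min\{\|z-x\|,\|z+x\|\}$ and, for $K\ge \log^{1.5}m$, $\Upsilon_c(K)=\{x\in\mathbb R^n:(1-c)K\le\|x\|\le(1+c)K\}$. Then, with probability over $\{a_i\}$ tending to one as $n\to\infty$ (with $m=\kappa n$), uniformly in $K\ge\log^{1.5}m$, $$\inf_{\hat x}\ \sup_{x\in\Upsilon_c(K)}\ \mathbb E\big[\mathrm{dist}(\hat x,x)\,\big|\,\{a_i\}_{1\le i\le m}\big]\ \ge\ \frac{\varepsilon_1}{\sqrt\kappa},$$ where the infimum is over all estimators $\hat x$, i.e. all (possibly randomized) functions of the data $(y_i)$ and the design $\{a_i\}$ with values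 in $\mathbb R^n$. Explicitly: for every $\eta>0$ there is $N=N(c,\kappa,\eta)$ such that for all integers $n\ge N$ and $m$ with $m=\kappa n$ and all $K\ge\log^{1.5}m$, the (outer) probability that the inequality fails is at most $\eta$. -/

import Mathlib

open MeasureTheory ProbabilityTheory
open scoped ENNReal

noncomputable section

/-- Distance modulo the unrecoverable global sign (real-valued case). -/
def signDist {n : ℕ} (z x : EuclideanSpace ℝ (Fin n)) : ℝ :=
  min ‖z - x‖ ‖z + x‖

/-- Law of an independent family `a₁, …, aₘ` of design vectors, each standard Gaussian on `ℝⁿ`. -/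
def gaussianDesign (m n : ℕ) : Measure (Fin m → EuclideanSpace ℝ (Fin n)) :=
  Measure.pi fun _ => stdGaussian (EuclideanSpace ℝ (Fin n))

/-- Conditional law of the data given the design `a` when the signal is `x`:
`yᵢ ∼ Poisson(|⟨aᵢ, x⟩|²)`, independently over `i`. -/
def poissonModel {m n : ℕ} (a : Fin m → EuclideanSpace ℝ (Fin n))
    (x : EuclideanSpace ℝ (Fin n)) : Measure (Fin m → ℕ) :=
  Measure.pi fun i => poissonMeasure (‖inner ℝ (a i) x‖₊ ^ 2)

theorem measurable_poissonModel {m n : ℕ} (a : Fin m → EuclideanSpace ℝ (Fin n)) :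
    Measurable (poissonModel a) := by
  refine Measure.measurable_of_measurable_coe _ fun s _ => ?_
  have h : ∀ x, poissonModel a x s = ∑' y : s, poissonModel a x {(y : Fin m → ℕ)} := fun x =>
    by rw [← measure_biUnion s.to_countable (by intro i _ j _ h; simpa using h) (fun _ _ => .of_discrete)]; simp
  simp_rw [h, poissonModel, Measure.pi_singleton, poissonMeasure_singleton]
  fun_prop

/-- The shell `{x ∈ ℝⁿ : (1 - c) K ≤ ‖x‖ ≤ (1 + c) K}`. -/
def shell (n : ℕ) (c K : ℝ) : Set (EuclideanSpace ℝ (Fin n)) :=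
  {x | (1 - c) * K ≤ ‖x‖ ∧ ‖x‖ ≤ (1 + c) * K}

/-- The statistical model with parameter set `S`, given the design `a`: each signal `x ∈ S` is sent
to the conditional law of the data. -/
def poissonModelKernel {m n : ℕ} (a : Fin m → EuclideanSpace ℝ (Fin n))
    (S : Set (EuclideanSpace ℝ (Fin n))) : Kernel S (Fin m → ℕ) where
  toFun x := poissonModel a x
  measurable' := (measurable_poissonModel a).comp measurable_subtype_coe

/-- Conditional minimax risk `inf_{x̂} sup_{x ∈ S} E[dist(x̂, x) | {aᵢ}]`, with values in `[0, ∞]`.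
The design `a` is fixed when the infimum is taken, so estimators may depend on it in any way.
Estimators are Markov kernels from the data to `ℝⁿ`; deterministic estimators are a special case. -/
def condMinimaxRisk {m n : ℕ} (a : Fin m → EuclideanSpace ℝ (Fin n))
    (S : Set (EuclideanSpace ℝ (Fin n))) : ℝ≥0∞ :=
  minimaxRisk (fun (x : S) (z : EuclideanSpace ℝ (Fin n)) => ENNReal.ofReal (signDist z x))
    (poissonModelKernel a S)

end

theorem exp_sq_div_four_mul_gaussianPDFReal (x : ℝ) :
    gaussianPDFReal 0 1 x * Real.exp (x ^ 2 / 4) =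
      (√(2 * Real.pi))⁻¹ * Real.exp (-(1 / 4) * x ^ 2) := by
  rw [gaussianPDFReal, mul_assoc, ← Real.exp_add]
  congr 2
  · simp
  · simp; ring

theorem integrable_exp_sq_div_four_gaussianReal :
    Integrable (fun x : ℝ => Real.exp (x ^ 2 / 4)) (gaussianReal 0 1) := by
  rw [gaussianReal_of_var_ne_zero _ one_ne_zero,
    integrable_withDensity_iff_integrable_smul' (by fun_prop) (by simp [gaussianPDF])]
  simp only [toReal_gaussianPDF, smul_eq_mul, exp_sq_div_four_mul_gaussianPDFReal]
  exact (integrable_exp_neg_mul_sq (by norm_num)).const_mul _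

theorem integral_exp_sq_div_four_gaussianReal :
    ∫ x : ℝ, Real.exp (x ^ 2 / 4) ∂(gaussianReal 0 1) = √2 := by
  rw [integral_gaussianReal_eq_integral_smul one_ne_zero]
  simp only [smul_eq_mul, exp_sq_div_four_mul_gaussianPDFReal]
  rw [integral_const_mul, integral_gaussian, ← Real.sqrt_inv, ← Real.sqrt_mul (by positivity)]
  congr 1
  field_simp
  norm_num

theorem exp_norm_sq_div_four_eq_prod {n : ℕ} (x : EuclideanSpace ℝ (Fin n)) :
    Real.exp (‖x‖ ^ 2 / 4) = ∏ j, Real.exp (x j ^ 2 / 4) := by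
  rw [EuclideanSpace.real_norm_sq_eq, Finset.sum_div, Real.exp_sum]

theorem integrable_exp_norm_sq_div_four_stdGaussian (n : ℕ) :
    Integrable (fun x : EuclideanSpace ℝ (Fin n) => Real.exp (‖x‖ ^ 2 / 4))
      (stdGaussian (EuclideanSpace ℝ (Fin n))) := by
  rw [← map_pi_eq_stdGaussian, integrable_map_measure
    (by fun_prop) (Measurable.aemeasurable (by fun_prop))]
  simp only [Function.comp_def, exp_norm_sq_div_four_eq_prod]
  exact Integrable.fintype_prod (f := fun _ x => Real.exp (x ^ 2 / 4))
    fun _ => integrable_exp_sq_div_four_gaussianReal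

theorem integral_exp_norm_sq_div_four_stdGaussian (n : ℕ) :
    ∫ x, Real.exp (‖x‖ ^ 2 / 4) ∂(stdGaussian (EuclideanSpace ℝ (Fin n))) = √2 ^ n := by
  rw [← map_pi_eq_stdGaussian, integral_map (Measurable.aemeasurable (by fun_prop)) (by fun_prop)]
  simp only [exp_norm_sq_div_four_eq_prod]
  rw [integral_fintype_prod_eq_prod (f := fun _ x => Real.exp (x ^ 2 / 4))]
  simp [integral_exp_sq_div_four_gaussianReal]

instance isProbabilityMeasure_gaussianDesign (m n : ℕ) :
    IsProbabilityMeasure (gaussianDesign m n) := by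
  unfold gaussianDesign; infer_instance

theorem gaussianDesign_sum_norm_sq_ge_le (m n : ℕ) :
    gaussianDesign m n {a | 4 * (n * m : ℝ) ≤ ∑ i, ‖a i‖ ^ 2} ≤
      ENNReal.ofReal (Real.exp (-(n * m : ℝ) / 2)) := by
  have hint : Integrable (fun a : Fin m → EuclideanSpace ℝ (Fin n) =>
      ∏ i, Real.exp (‖a i‖ ^ 2 / 4)) (gaussianDesign m n) :=
    Integrable.fintype_prod (f := fun _ x => Real.exp (‖x‖ ^ 2 / 4))
      fun _ => integrable_exp_norm_sq_div_four_stdGaussian n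
  have hval : ∫ a, ∏ i, Real.exp (‖a i‖ ^ 2 / 4) ∂(gaussianDesign m n) = √2 ^ (n * m) := by
    rw [gaussianDesign, integral_fintype_prod_eq_prod (f := fun _ x => Real.exp (‖x‖ ^ 2 / 4))]
    simp [integral_exp_norm_sq_div_four_stdGaussian, pow_mul]
  have hM := mul_meas_ge_le_integral_of_nonneg
    (Filter.Eventually.of_forall fun a => by positivity) hint (Real.exp (n * m))
  rw [hval] at hM
  have hset : {a : Fin m → EuclideanSpace ℝ (Fin n) | 4 * (n * m : ℝ) ≤ ∑ i, ‖a i‖ ^ 2} =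
      {a | Real.exp (n * m) ≤ ∏ i, Real.exp (‖a i‖ ^ 2 / 4)} := by
    ext a
    simp only [Set.mem_ofPred_eq]
    rw [← Real.exp_sum, Real.exp_le_exp, ← Finset.sum_div, le_div_iff₀ (by norm_num), mul_comm]
  rw [hset, ← ofReal_measureReal]
  refine ENNReal.ofReal_le_ofReal ?_
  have h2 : √2 ^ (n * m) ≤ Real.exp ((n * m : ℝ) / 2) := by
    have h : √2 ≤ Real.exp (1 / 2) := by
      rw [Real.sqrt_le_left (by positivity), ← Real.exp_nat_mul]
      have := Real.add_one_le_exp (1 : ℝ)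
      norm_num at this ⊢
      linarith
    calc √2 ^ (n * m) ≤ Real.exp (1 / 2) ^ (n * m) := by gcongr
      _ = _ := by rw [← Real.exp_nat_mul]; push_cast; ring_nf
  have h3 : Real.exp (-(n * m : ℝ) / 2) = Real.exp ((n * m : ℝ) / 2) / Real.exp (n * m) := by
    rw [← Real.exp_sub]; ring_nf
  rw [h3, le_div_iff₀ (Real.exp_pos _), mul_comm]
  exact hM.trans h2

instance isProbabilityMeasure_poissonModel {m n : ℕ} (a : Fin m → EuclideanSpace ℝ (Fin n))
    (x : EuclideanSpace ℝ (Fin n)) : IsProbabilityMeasure (poissonModel a x) := by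
  unfold poissonModel; infer_instance

/-- The normalized geometric mean of two Poisson laws is the Poisson law at the geometric mean
of the rates. -/
theorem poissonMeasure_real_singleton_mul (s t : NNReal) (k : ℕ) :
    (poissonMeasure (s ^ 2)).real {k} * (poissonMeasure (t ^ 2)).real {k} =
      Real.exp (-((s : ℝ) - t) ^ 2) * (poissonMeasure (s * t)).real {k} ^ 2 := by
  simp only [poissonMeasure_real_singleton, NNReal.coe_pow, NNReal.coe_mul]
  have h : Real.exp (-(s : ℝ) ^ 2) * Real.exp (-(t : ℝ) ^ 2) =
      Real.exp (-((s : ℝ) - t) ^ 2) * Real.exp (-((s : ℝ) * t)) ^ 2 := by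
    rw [← Real.exp_add, ← Real.exp_nat_mul, ← Real.exp_add]
    push_cast; ring_nf
  calc _ = (Real.exp (-(s : ℝ) ^ 2) * Real.exp (-(t : ℝ) ^ 2)) *
        ((s : ℝ) ^ 2) ^ k * ((t : ℝ) ^ 2) ^ k / (k.factorial : ℝ) ^ 2 := by
        field_simp
    _ = _ := by rw [h]; ring

/-- The normalized geometric mean of the laws of the data at two signals. -/
noncomputable def poissonGeomMean {m n : ℕ} (a : Fin m → EuclideanSpace ℝ (Fin n))
    (x x' : EuclideanSpace ℝ (Fin n)) : Measure (Fin m → ℕ) :=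
  Measure.pi fun i => poissonMeasure (‖inner ℝ (a i) x‖₊ * ‖inner ℝ (a i) x'‖₊)

instance isProbabilityMeasure_poissonGeomMean {m n : ℕ} (a : Fin m → EuclideanSpace ℝ (Fin n))
    (x x' : EuclideanSpace ℝ (Fin n)) : IsProbabilityMeasure (poissonGeomMean a x x') := by
  unfold poissonGeomMean; infer_instance

theorem measureReal_pi_singleton {m : ℕ} (μ : Fin m → Measure ℕ)
    [∀ i, IsProbabilityMeasure (μ i)] (y : Fin m → ℕ) :
    (Measure.pi μ).real {y} = ∏ i, (μ i).real {y i} := by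
  simp [measureReal_def, Measure.pi_singleton, ENNReal.toReal_prod]

/-- Squared Bhattacharyya affinity of the laws of the data at two signals. -/
noncomputable def sqAffinity {m n : ℕ} (a : Fin m → EuclideanSpace ℝ (Fin n))
    (x x' : EuclideanSpace ℝ (Fin n)) : ℝ :=
  Real.exp (-∑ i, (|inner ℝ (a i) x| - |inner ℝ (a i) x'|) ^ 2)

theorem one_sub_le_sqAffinity {m n : ℕ} (a : Fin m → EuclideanSpace ℝ (Fin n))
    (x x' : EuclideanSpace ℝ (Fin n)) :
    1 - ∑ i, (inner ℝ (a i) (x - x')) ^ 2 ≤ sqAffinity a x x' := by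
  have h : ∑ i, (|inner ℝ (a i) x| - |inner ℝ (a i) x'|) ^ 2 ≤
      ∑ i, (inner ℝ (a i) (x - x')) ^ 2 := by
    refine Finset.sum_le_sum fun i _ => ?_
    rw [inner_sub_right]
    exact sq_le_sq.2 (abs_abs_sub_abs_le_abs_sub _ _)
  have := Real.add_one_le_exp (-∑ i, (|inner ℝ (a i) x| - |inner ℝ (a i) x'|) ^ 2)
  unfold sqAffinity
  linarith

theorem poissonModel_real_singleton_mul {m n : ℕ} (a : Fin m → EuclideanSpace ℝ (Fin n))
    (x x' : EuclideanSpace ℝ (Fin n)) (y : Fin m → ℕ) :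
    (poissonModel a x).real {y} * (poissonModel a x').real {y} =
      sqAffinity a x x' * (poissonGeomMean a x x').real {y} ^ 2 := by
  simp only [poissonModel, poissonGeomMean, measureReal_pi_singleton, sqAffinity]
  rw [← Finset.sum_neg_distrib, Real.exp_sum, ← Finset.prod_mul_distrib, ← Finset.prod_pow,
    ← Finset.prod_mul_distrib]
  refine Finset.prod_congr rfl fun i _ => ?_
  rw [poissonMeasure_real_singleton_mul]
  simp

theorem mul_le_add_mul_of_mul_eq {p q r C s t : ℝ} (hp : 0 ≤ p) (hq : 0 ≤ q)
    (hC : 0 ≤ C) (hs : 0 ≤ s) (ht : 0 ≤ t) (hst : 1 ≤ s + t) (h : p * q = C * r ^ 2) :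
    C * r ≤ s * p + t * q + C / 4 * (p + q) := by
  wlog hpq : p ≤ q generalizing p q s t
  · have := this hq hp ht hs (by linarith) (by linarith) (by linarith)
    linarith
  have h1 : p ≤ s * p + t * q := by nlinarith
  have h2 : C * r ≤ p + C / 4 * q := by
    refine abs_le_of_sq_le_sq' ?_ (by positivity) |>.2
    nlinarith [sq_nonneg (p - C / 4 * q)]
  nlinarith [mul_nonneg hC hp]

/-- Two-point bound: the sum of the errors of a randomized test between two signals. -/
theorem sqAffinity_div_two_le_integral_add {m n : ℕ} (a : Fin m → EuclideanSpace ℝ (Fin n))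
    (x x' : EuclideanSpace ℝ (Fin n)) {f g : (Fin m → ℕ) → ℝ≥0∞} (hf : ∀ y, f y ≤ 1)
    (hg : ∀ y, g y ≤ 1) (hfg : ∀ y, 1 ≤ f y + g y) :
    ENNReal.ofReal (sqAffinity a x x' / 2) ≤
      ∫⁻ y, f y ∂(poissonModel a x) + ∫⁻ y, g y ∂(poissonModel a x') := by
  set C := sqAffinity a x x' with hCdef
  have hC : 0 ≤ C := (Real.exp_pos _).le
  have key : ∀ y, ENNReal.ofReal C * poissonGeomMean a x x' {y} ≤
      f y * poissonModel a x {y} + g y * poissonModel a x' {y} +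
        ENNReal.ofReal (C / 4) * (poissonModel a x {y} + poissonModel a x' {y}) := by
    intro y
    have hfy : f y ≠ ∞ := ((hf y).trans_lt ENNReal.one_lt_top).ne
    have hgy : g y ≠ ∞ := ((hg y).trans_lt ENNReal.one_lt_top).ne
    have h := mul_le_add_mul_of_mul_eq (p := (poissonModel a x).real {y})
      (q := (poissonModel a x').real {y}) (r := (poissonGeomMean a x x').real {y})
      (s := (f y).toReal) (t := (g y).toReal) measureReal_nonneg measureReal_nonneg
      hC ENNReal.toReal_nonneg ENNReal.toReal_nonneg
      (by
        rw [← ENNReal.toReal_add hfy hgy, ← ENNReal.toReal_one]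
        exact ENNReal.toReal_mono (by finiteness) (hfg y))
      (poissonModel_real_singleton_mul a x x' y)
    have h' := ENNReal.ofReal_le_ofReal h
    rw [ENNReal.ofReal_add (by positivity) (by positivity),
      ENNReal.ofReal_add (by positivity) (by positivity), ENNReal.ofReal_mul hC,
      ENNReal.ofReal_mul (by positivity), ENNReal.ofReal_mul (by positivity),
      ENNReal.ofReal_mul (by positivity), ENNReal.ofReal_add (by positivity) (by positivity),
      ENNReal.ofReal_toReal hfy, ENNReal.ofReal_toReal hgy, ofReal_measureReal,
      ofReal_measureReal, ofReal_measureReal] at h'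
    exact h'
  have hsum : ∀ (μ : Measure (Fin m → ℕ)) [IsProbabilityMeasure μ], ∑' y, μ {y} = 1 := by
    intro μ _
    have := lintegral_countable' (μ := μ) (fun _ => 1)
    simpa using this.symm
  have h := ENNReal.tsum_le_tsum key
  rw [ENNReal.tsum_add, ENNReal.tsum_add, ENNReal.tsum_mul_left, ENNReal.tsum_mul_left,
    ENNReal.tsum_add, hsum, hsum, hsum, ← lintegral_countable', ← lintegral_countable'] at h
  have h4 : ENNReal.ofReal C * 1 =
      ENNReal.ofReal (C / 2) + ENNReal.ofReal (C / 4) * (1 + 1) := by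
    rw [one_add_one_eq_two, ← ENNReal.ofReal_ofNat, ← ENNReal.ofReal_mul (by positivity),
      ← ENNReal.ofReal_add (by positivity) (by positivity), mul_one]
    ring_nf
  rw [h4] at h
  exact (ENNReal.add_le_add_iff_right (by finiteness)).1 h

theorem signDist_neg_left {n : ℕ} (z x : EuclideanSpace ℝ (Fin n)) :
    signDist (-z) x = signDist z x := by
  rw [signDist, signDist, min_comm, neg_add_eq_sub, norm_sub_rev, ← neg_add', norm_neg]

/-- The coordinates of the center `K e₀` of the hypercube. -/
noncomputable def cubeCenter {n : ℕ} [NeZero n] (K : ℝ) : Fin n → ℝ := Pi.single 0 K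

/-- The vertices of the hypercube of half-side `δ` around `K e₀`. -/
noncomputable def cubeVertex {n : ℕ} [NeZero n] (K δ : ℝ) (v : Fin n → Bool) :
    EuclideanSpace ℝ (Fin n) :=
  WithLp.toLp 2 fun j => cubeCenter K j + if v j then δ else -δ

/-- The points which, after normalizing the sign, lie above the center of the hypercube in
coordinate `j`. -/
def aboveCenter {n : ℕ} [NeZero n] (K : ℝ) (j : Fin n) : Set (EuclideanSpace ℝ (Fin n)) :=
  {z | (0 ≤ z 0 ∧ cubeCenter K j ≤ z j) ∨ (z 0 < 0 ∧ cubeCenter K j ≤ -z j)}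

theorem measurableSet_aboveCenter {n : ℕ} [NeZero n] (K : ℝ) (j : Fin n) :
    MeasurableSet (aboveCenter K j) := by
  have h0 : Measurable fun z : EuclideanSpace ℝ (Fin n) => z 0 := by fun_prop
  have hj : Measurable fun z : EuclideanSpace ℝ (Fin n) => z j := by fun_prop
  exact ((measurableSet_le measurable_const h0).inter (measurableSet_le measurable_const hj)).union
    ((measurableSet_lt h0 measurable_const).inter (measurableSet_le measurable_const hj.neg))

/-- The points which misidentify the sign of the `j`th coordinate of the vertex `v`. -/
def cubeError {n : ℕ} [NeZero n] (K : ℝ) (v : Fin n → Bool) (j : Fin n) :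
    Set (EuclideanSpace ℝ (Fin n)) :=
  if v j then (aboveCenter K j)ᶜ else aboveCenter K j

theorem measurableSet_cubeError {n : ℕ} [NeZero n] (K : ℝ) (v : Fin n → Bool) (j : Fin n) :
    MeasurableSet (cubeError K v j) := by
  unfold cubeError
  split_ifs
  exacts [(measurableSet_aboveCenter K j).compl, measurableSet_aboveCenter K j]

theorem norm_cubeVertex_sub {n : ℕ} [NeZero n] (K : ℝ) {δ : ℝ} (hδ : 0 ≤ δ) (v : Fin n → Bool) :
    ‖cubeVertex K δ v - WithLp.toLp 2 (cubeCenter K)‖ = δ * √n := by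
  rw [EuclideanSpace.norm_eq]
  have h : ∀ j, ‖(cubeVertex K δ v - WithLp.toLp 2 (cubeCenter K)).ofLp j‖ ^ 2 = δ ^ 2 := by
    intro j
    simp only [cubeVertex, PiLp.sub_apply, add_sub_cancel_left]
    split_ifs <;> simp
  simp only [h, Finset.sum_const, Finset.card_univ, Fintype.card_fin, nsmul_eq_mul]
  rw [mul_comm, Real.sqrt_mul (sq_nonneg _), Real.sqrt_sq hδ]

theorem cubeVertex_mem_shell {n : ℕ} [NeZero n] {K δ c : ℝ} (hK : 0 ≤ K) (hδ : 0 ≤ δ)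
    (h : δ * √n ≤ c * K) (v : Fin n → Bool) : cubeVertex K δ v ∈ shell n c K := by
  have hc : ‖(WithLp.toLp 2 (cubeCenter K) : EuclideanSpace ℝ (Fin n))‖ = K := by
    have h := PiLp.norm_single 2 (fun _ : Fin n => ℝ) 0 K
    rwa [Real.norm_of_nonneg hK] at h
  have h1 := norm_cubeVertex_sub K hδ v
  have h2 := abs_le.1 (abs_norm_sub_norm_le (cubeVertex K δ v) (WithLp.toLp 2 (cubeCenter K)))
  rw [hc, h1] at h2
  constructor <;> linarith [h2.1, h2.2]

theorem sum_indicator_cubeError_le_signDist {n : ℕ} [NeZero n] {K δ : ℝ} (hδ : 0 ≤ δ)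
    (hK : 2 * δ * √n ≤ K) (v : Fin n → Bool) (z : EuclideanSpace ℝ (Fin n)) :
    δ / √n * ∑ j, (cubeError K v j).indicator 1 z ≤ signDist z (cubeVertex K δ v) := by
  wlog hz : 0 ≤ z 0 generalizing z
  · push Not at hz
    by_cases hz' : 0 < (-z) 0
    · have := this (-z) hz'.le
      rw [signDist_neg_left] at this
      have h : ∀ j, -z ∈ aboveCenter K j ↔ z ∈ aboveCenter K j := by
        simp [aboveCenter, hz.le, hz, not_le.2 hz, not_lt.2 hz.le]
      have h' : ∀ j, (cubeError K v j).indicator (1 : EuclideanSpace ℝ (Fin n) → ℝ) (-z) =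
          (cubeError K v j).indicator 1 z := by
        intro j
        have hiff : -z ∈ cubeError K v j ↔ z ∈ cubeError K v j := by
          unfold cubeError
          split_ifs <;> simp [h]
        by_cases hj : z ∈ cubeError K v j
        · rw [Set.indicator_of_mem hj, Set.indicator_of_mem (hiff.2 hj)]
          rfl
        · rw [Set.indicator_of_notMem hj, Set.indicator_of_notMem (mt hiff.1 hj)]
      simpa only [h'] using this
    · exact absurd (by simpa using hz) hz'
  have hn : (0 : ℝ) < n := by exact_mod_cast Nat.pos_of_ne_zero (NeZero.ne n)
  have hsn : 0 < √(n : ℝ) := Real.sqrt_pos.2 hn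
  have hsq : √(n : ℝ) * √n = n := Real.mul_self_sqrt hn.le
  have hsn1 : 1 ≤ √(n : ℝ) := by
    rw [Real.one_le_sqrt]; exact_mod_cast Nat.pos_of_ne_zero (NeZero.ne n)
  set H : ℝ := ∑ j, (cubeError K v j).indicator 1 z with hH
  have hH0 : 0 ≤ H := Finset.sum_nonneg fun j _ => Set.indicator_nonneg (by simp) _
  have hHn : H ≤ n := by
    calc H ≤ ∑ _j : Fin n, (1 : ℝ) :=
          Finset.sum_le_sum fun j _ => Set.indicator_le_self' (by simp) z
      _ = n := by simp
  have hb : δ / √n * H ≤ δ * √n := by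
    rw [div_mul_eq_mul_div, div_le_iff₀ hsn, mul_assoc, hsq]
    gcongr
  refine le_min ?_ ?_
  · have hsum : δ ^ 2 * H ≤ ‖z - cubeVertex K δ v‖ ^ 2 := by
      rw [EuclideanSpace.real_norm_sq_eq, hH, Finset.mul_sum]
      refine Finset.sum_le_sum fun j _ => ?_
      by_cases hj : z ∈ cubeError K v j
      · rw [Set.indicator_of_mem hj, Pi.one_apply, mul_one, PiLp.sub_apply]
        simp only [cubeError, cubeVertex] at hj ⊢
        split_ifs at hj ⊢ with hv
        · have : z j < cubeCenter K j := by
            by_contra! hlt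
            exact hj (Or.inl ⟨hz, hlt⟩)
          nlinarith
        · have : cubeCenter K j ≤ z j := by
            rcases hj with hj | hj
            exacts [hj.2, absurd hz (not_le.2 hj.1)]
          nlinarith
      · rw [Set.indicator_of_notMem hj, mul_zero]
        exact sq_nonneg _
    refine abs_le_of_sq_le_sq' (hsum.trans' ?_) (norm_nonneg _) |>.2
    rw [mul_pow, div_pow, Real.sq_sqrt hn.le, div_mul_eq_mul_div, div_le_iff₀ hn]
    nlinarith [mul_nonneg (mul_nonneg (sq_nonneg δ) hH0) (sub_nonneg.2 hHn)]
  · refine hb.trans ?_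
    have h0 := PiLp.norm_apply_le (z + cubeVertex K δ v) (0 : Fin n)
    refine le_trans ?_ ((le_abs_self _).trans h0)
    simp only [PiLp.add_apply, cubeVertex, cubeCenter, Pi.single_eq_same]
    split_ifs <;> nlinarith

/-- Flip the sign of one coordinate. -/
def flipAt {n : ℕ} (j : Fin n) (v : Fin n → Bool) : Fin n → Bool := Function.update v j (!v j)

theorem flipAt_involutive {n : ℕ} (j : Fin n) : Function.Involutive (flipAt j) := by
  intro v
  simp [flipAt]

theorem inner_cubeVertex_sub_flipAt_sq {n : ℕ} [NeZero n] (K δ : ℝ) (v : Fin n → Bool) (j : Fin n)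
    (b : EuclideanSpace ℝ (Fin n)) :
    (inner ℝ b (cubeVertex K δ v - cubeVertex K δ (flipAt j v))) ^ 2 = 4 * δ ^ 2 * b j ^ 2 := by
  have h : cubeVertex K δ v - cubeVertex K δ (flipAt j v) =
      EuclideanSpace.single j (if v j then 2 * δ else -2 * δ) := by
    ext i
    by_cases hi : i = j
    · subst hi
      cases hv : v i <;> simp [cubeVertex, flipAt, hv] <;> ring
    · simp [cubeVertex, flipAt, hi]
  rw [h, EuclideanSpace.inner_single_right]
  split_ifs <;> simp <;> ring

theorem measureReal_cubeError_add_flipAt {m n : ℕ} [NeZero n]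
    (a : Fin m → EuclideanSpace ℝ (Fin n)) (K δ : ℝ)
    (k : Kernel (Fin m → ℕ) (EuclideanSpace ℝ (Fin n))) [IsMarkovKernel k]
    (v : Fin n → Bool) (j : Fin n) :
    (1 - 4 * δ ^ 2 * ∑ i, a i j ^ 2) / 2 ≤
      (k ∘ₘ poissonModel a (cubeVertex K δ v)).real (cubeError K v j) +
      (k ∘ₘ poissonModel a (cubeVertex K δ (flipAt j v))).real
        (cubeError K (flipAt j v) j) := by
  have hc : cubeError K (flipAt j v) j = (cubeError K v j)ᶜ := by
    cases hv : v j <;> simp [cubeError, flipAt, hv]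
  have h1 := one_sub_le_sqAffinity a (cubeVertex K δ v) (cubeVertex K δ (flipAt j v))
  simp only [inner_cubeVertex_sub_flipAt_sq, ← Finset.mul_sum] at h1
  have hm := measurableSet_cubeError K v j
  have h2 := sqAffinity_div_two_le_integral_add a (cubeVertex K δ v) (cubeVertex K δ (flipAt j v))
    (f := fun y => k y (cubeError K v j)) (g := fun y => k y (cubeError K v j)ᶜ)
    (fun y => prob_le_one) (fun y => prob_le_one) (fun y => (prob_add_prob_compl hm).ge)
  rw [← Measure.bind_apply hm (Kernel.aemeasurable _),
    ← Measure.bind_apply hm.compl (Kernel.aemeasurable _), ← ofReal_measureReal,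
    ← ofReal_measureReal, ← ENNReal.ofReal_add measureReal_nonneg measureReal_nonneg,
    ENNReal.ofReal_le_ofReal_iff (by positivity)] at h2
  rw [hc]
  linarith

/-- Assouad's argument: at some vertex, the expected number of misidentified signs is of order
`n`. -/
theorem exists_sum_measureReal_cubeError_ge {m n : ℕ} [NeZero n]
    (a : Fin m → EuclideanSpace ℝ (Fin n)) (K δ : ℝ)
    (k : Kernel (Fin m → ℕ) (EuclideanSpace ℝ (Fin n))) [IsMarkovKernel k] :
    ∃ v, (n - 4 * δ ^ 2 * ∑ i, ‖a i‖ ^ 2) / 4 ≤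
      ∑ j, (k ∘ₘ poissonModel a (cubeVertex K δ v)).real (cubeError K v j) := by
  set e : (Fin n → Bool) → Fin n → ℝ := fun v j =>
    (k ∘ₘ poissonModel a (cubeVertex K δ v)).real (cubeError K v j) with he
  have hj : ∀ j, ∑ _v : Fin n → Bool, (1 - 4 * δ ^ 2 * ∑ i, a i j ^ 2) / 4 ≤ ∑ v, e v j := by
    intro j
    have h1 : ∑ v, e (flipAt j v) j = ∑ v, e v j :=
      Equiv.sum_comp (flipAt_involutive j).toPerm fun v => e v j
    have h2 := Finset.sum_le_sum fun v (_ : v ∈ Finset.univ) =>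
      measureReal_cubeError_add_flipAt a K δ k v j
    rw [Finset.sum_add_distrib] at h2
    change _ ≤ ∑ v, e v j + ∑ v, e (flipAt j v) j at h2
    rw [h1] at h2
    simp only [Finset.sum_const, nsmul_eq_mul] at h2 ⊢
    linarith
  have hsum : ∑ j, (1 - 4 * δ ^ 2 * ∑ i, a i j ^ 2) / 4 =
      (n - 4 * δ ^ 2 * ∑ i, ‖a i‖ ^ 2) / 4 := by
    simp only [EuclideanSpace.real_norm_sq_eq]
    rw [← Finset.sum_div, Finset.sum_sub_distrib, ← Finset.mul_sum, Finset.sum_comm]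
    simp
  obtain ⟨v, -, hv⟩ := Finset.exists_le_of_sum_le (s := Finset.univ)
    (f := fun _ : Fin n → Bool => (n - 4 * δ ^ 2 * ∑ i, ‖a i‖ ^ 2) / 4)
    (g := fun v => ∑ j, e v j) Finset.univ_nonempty (by
      rw [Finset.sum_comm (f := fun v j => e v j)]
      simp only [← hsum]
      rw [Finset.sum_comm]
      exact Finset.sum_le_sum fun j _ => hj j)
  exact ⟨v, hv⟩

theorem le_condMinimaxRisk_shell {m n : ℕ} [NeZero n] (a : Fin m → EuclideanSpace ℝ (Fin n))
    {c K δ : ℝ} (hδ : 0 ≤ δ) (hK : 2 * δ * √n ≤ K) (hcK : δ * √n ≤ c * K) :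
    ENNReal.ofReal (δ / √n * ((n - 4 * δ ^ 2 * ∑ i, ‖a i‖ ^ 2) / 4)) ≤
      condMinimaxRisk a (shell n c K) := by
  refine le_iInf₂ fun k _ => ?_
  obtain ⟨v, hv⟩ := exists_sum_measureReal_cubeError_ge a K δ k
  have hK0 : 0 ≤ K := le_trans (by positivity) hK
  refine le_trans ?_ (le_iSup _ (⟨cubeVertex K δ v, cubeVertex_mem_shell hK0 hδ hcK v⟩ :
    shell n c K))
  rw [Kernel.comp_apply]
  change _ ≤ ∫⁻ z, ENNReal.ofReal (signDist z (cubeVertex K δ v))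
    ∂(k ∘ₘ poissonModel a (cubeVertex K δ v))
  set μ := k ∘ₘ poissonModel a (cubeVertex K δ v) with hμ
  have hms := measurableSet_cubeError K v
  have hint : ∀ j, Integrable ((cubeError K v j).indicator (1 : EuclideanSpace ℝ (Fin n) → ℝ)) μ := fun j =>
    (integrable_const (1 : ℝ)).indicator (hms j)
  calc ENNReal.ofReal (δ / √n * ((n - 4 * δ ^ 2 * ∑ i, ‖a i‖ ^ 2) / 4))
      ≤ ENNReal.ofReal (δ / √n * ∑ j, μ.real (cubeError K v j)) := by gcongr
    _ = ENNReal.ofReal (∫ z, δ / √n * ∑ j, (cubeError K v j).indicator 1 z ∂μ) := by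
      rw [integral_const_mul, integral_finsetSum _ fun j _ => hint j]
      simp only [integral_indicator_one (hms _)]
    _ = ∫⁻ z, ENNReal.ofReal (δ / √n * ∑ j, (cubeError K v j).indicator 1 z) ∂μ := by
      refine ofReal_integral_eq_lintegral_ofReal ?_ (Filter.Eventually.of_forall fun z => ?_)
      · exact (integrable_finsetSum _ fun j _ => hint j).const_mul _
      · exact mul_nonneg (by positivity)
          (Finset.sum_nonneg fun j _ => Set.indicator_nonneg (by simp) _)
    _ ≤ _ := lintegral_mono fun z =>
      ENNReal.ofReal_le_ofReal (sum_indicator_cubeError_le_signDist hδ hK v z)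

theorem theorem3 :
    ∃ ε₁ : ℝ, 0 < ε₁ ∧
      ∀ c : ℝ, 0 < c → c < 1 / 2 →
      ∀ κ : ℝ, 0 < κ →
      ∀ η : ℝ, 0 < η →
      ∃ N : ℕ, ∀ n m : ℕ, N ≤ n → (m : ℝ) = κ * (n : ℝ) →
        ∀ K : ℝ, Real.log (m : ℝ) ^ (3 / 2 : ℝ) ≤ K →
          gaussianDesign m n
            {a | ¬ ENNReal.ofReal (ε₁ / √κ) ≤ condMinimaxRisk a (shell n c K)}
            ≤ ENNReal.ofReal η := by
  refine ⟨1 / 64, by norm_num, fun c hc hc2 κ hκ η hη => ?_⟩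
  have hlim : Filter.Tendsto (fun n : ℕ => Real.log (κ * n) ^ (3 / 2 : ℝ))
      Filter.atTop Filter.atTop :=
    (tendsto_rpow_atTop (by norm_num)).comp (Real.tendsto_log_atTop.comp
      (tendsto_natCast_atTop_atTop.const_mul_atTop hκ))
  have hexp : Filter.Tendsto (fun n : ℕ => Real.exp (-((n : ℝ) / 2))) Filter.atTop (nhds 0) :=
    Real.tendsto_exp_neg_atTop_nhds_zero.comp
      (tendsto_natCast_atTop_atTop.atTop_div_const (by norm_num))
  obtain ⟨N, hN⟩ := Filter.eventually_atTop.1 ((hlim.eventually_ge_atTop (1 / √κ / c)).and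
    ((hexp.eventually_le_const hη).and (Filter.eventually_ge_atTop 1)))
  refine ⟨N, fun n m hn hm K hK => ?_⟩
  obtain ⟨hlog, hη', hn1⟩ := hN n hn
  have : NeZero n := ⟨by omega⟩
  have hn0 : (0 : ℝ) < n := by exact_mod_cast hn1
  have hsκ : 0 < √κ := Real.sqrt_pos.2 hκ
  have hsn : 0 < √(n : ℝ) := Real.sqrt_pos.2 hn0
  have hsm : √(m : ℝ) = √κ * √n := by rw [hm, Real.sqrt_mul hκ.le]
  have hm0 : (0 : ℝ) < m := by rw [hm]; positivity
  have hm1 : (1 : ℝ) ≤ m := by exact_mod_cast hm0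
  set δ : ℝ := 1 / (6 * √m) with hδdef
  have hδ : 0 ≤ δ := by positivity
  have hδn : δ * √n = 1 / √κ / 6 := by rw [hδdef, hsm]; field_simp
  have hδ2 : δ ^ 2 = 1 / (36 * m) := by
    rw [hδdef, div_pow, mul_pow, Real.sq_sqrt hm0.le]; norm_num
  have hcK : 1 / √κ ≤ c * K := by
    rw [← hm] at hlog
    have := (div_le_iff₀ hc).1 (hlog.trans hK)
    linarith
  have hκ' : 0 < 1 / √κ := by positivity
  have hK0 : 0 < K := pos_of_mul_pos_right (hκ'.trans_le hcK) hc.le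
  refine le_trans (measure_mono fun a ha => ?_) ((gaussianDesign_sum_norm_sq_ge_le m n).trans
    (ENNReal.ofReal_le_ofReal (le_trans (Real.exp_le_exp.2 ?_) hη')))
  · by_contra hS
    simp only [Set.mem_ofPred_eq, not_le] at hS
    refine ha (le_trans (ENNReal.ofReal_le_ofReal ?_) (le_condMinimaxRisk_shell a hδ
      (c := c) (K := K) (by nlinarith) (by linarith)))
    have h1 : 4 * δ ^ 2 * ∑ i, ‖a i‖ ^ 2 ≤ 4 / 9 * (n : ℝ) := by
      calc 4 * δ ^ 2 * ∑ i, ‖a i‖ ^ 2 ≤ 4 * δ ^ 2 * (4 * (n * m)) := by gcongr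
        _ = 4 / 9 * (n : ℝ) := by rw [hδ2]; field_simp; norm_num
    calc 1 / 64 / √κ ≤ 1 / √κ / 6 * (5 / 36) := by
          rw [div_eq_mul_one_div (1 / 64) (√κ)]; linarith
      _ = δ / √n * (5 / 36 * n) := by
          rw [← hδn]; nth_rewrite 3 [← Real.sq_sqrt hn0.le]; field_simp
      _ ≤ _ := by gcongr; linarith
  · nlinarith
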